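/- Consider Plotkin's call-by-value $\lambda$-calculus: (possibly open) terms $t,u ::= v \mid t\,u$ up to $\alpha$-equivalence, with values $v ::= x \mid \lambda x.t$. Left contexts are $L ::= \langle\cdot\rangle \mid v\,L \mid L\,t$, and left reduction $\to_l$ is the closure under left contexts of $(\lambda x.t)\,v \mapsto t\{x\leftarrow v\}$ with $v$ a value. Write $t \Downarrow_l n$ if $t \to_l^* n$ and $n$ is $\to_l$-normal. A relation $\mathcal R$ on terms is an \emph{enf simulation} (eager normal form simulation) if $t \mathrel{\mathcal R} t'$ implies that at least one of the following holds: (1) $t$ has no $\to_l$-normal form; (2) $t \Downarrow_l x$ and $t' \Downarrow_l x$ for some variable $x$; (3) $t \Downarrow_l \lambda x.t_1$ and $t' \Downarrow_l \lambda x.t_1'$ with $t_1 \mathrel{\mathcal R} t_1'$; (4) $t \Downarrow_l L\langle x v\rangle$ and $t' \Downarrow_l L'\langle x v'\rangle$ with $v,v'$ values, $v \mathrel{\mathcal R} v'$ and $L\langle z\rangle \mathrel{\mathcal R} L'\langle z\rangle$, where $z$ is not free in $L$ or $L'$. Lassen's enf similarity $\precsim_{enf}$ is the union of all enf simulations. Linear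 types $L ::= M \multimap N$ and multi types $M,N ::= [L_1,\dots,L_n]$ ($n\ge 0$, finite multisets) are mutually inductively defined. Typing contexts $\Gamma$ assign multi types to finitely many variables (the other variables having the empty multi type $[\,]$), and $\uplus$ is the (pointwise) sum of multisets. Terms with explicit substitutions $t[x\leftarrow u]$ (of which the $\lambda$-terms above are a special case) are typed by the rules: (ax) $x:[L] \vdash x : L$; ($\lambda$) from $\Gamma, x:M \vdash t:N$ infer $\Gamma \vdash \lambda x.t : M\multimap N$; (many) from $\Gamma_i \vdash v : L_i$ for $i$ in a finite, possibly empty, set $I$, with $v$ a value, infer $\biguplus_{i\in I}\Gamma_i \vdash v : \biguplus_{i \in I}[L_i]$; (@) from $\Gamma \vdash t : [M\multimap N]$ and $\Delta\vdash u:M$ infer $\Gamma\uplus\Delta \vdash t\,u : N$; (es) from $\Gamma, x:M \vdash t:N$ and $\Delta \vdash u:M$ infer $\Gamma\uplus\Delta\vdash t[x\leftarrow u]:N$. The type preorder $t \precsim_{type} t'$ holds if, for all $\Gamma$ and all multi types $M$, $\Gamma\vdash t:M$ implies $\Gamma\vdash t':M$. \textbf{Proposition (Enf is included in Type).} 1.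 Let $\mathcal R$ be an enf simulation. If $t \mathrel{\mathcal R} t'$ and there is a derivation of $\Gamma \vdash t : M$, with $M$ a multi type, then there is a derivation of $\Gamma\vdash t' : M$. 2. If $t \precsim_{enf} t'$ then $t \precsim_{type} t'$. -/

import Mathlib

namespace CbV

/-! ## Plotkin's call-by-value lambda-calculus

Terms up to alpha-equivalence, with de Bruijn indices: variables are natural numbers, and under
a binder the index `0` is the bound variable while `n + 1` is the outer variable `n`. Terms may be
open, every natural number being available as a free variable. -/

/-- Terms `t, u ::= x | lam x. t | t u`. -/
inductive Tm : Type
  | var : ℕ → Tm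
  | lam : Tm → Tm
  | app : Tm → Tm → Tm

namespace Tm

/-- Values are variables and abstractions. -/
inductive IsValue : Tm → Prop
  | var (x : ℕ) : IsValue (var x)
  | lam (t : Tm) : IsValue (lam t)

/-- Capture-avoiding renaming of the free variables. -/
def rename : (ℕ → ℕ) → Tm → Tm
  | f, var x => var (f x)
  | f, lam t => lam (rename (fun n => Nat.casesOn n 0 (fun k => f k + 1)) t)
  | f, app t u => app (rename f t) (rename f u)

/-- Capture-avoiding parallel substitution of the free variables. -/
def subst : (ℕ → Tm) → Tm → Tm
  | s, var x => s x
  | s, lam t => lam (subst (fun n => Nat.casesOn n (var 0) (fun k => rename Nat.succ (s k))) t)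
  | s, app t u => app (subst s t) (subst s u)

/-- `t.inst u` is `t{x ← u}`, where `x` is the variable with index `0` in `t`, which disappears. -/
def inst (t u : Tm) : Tm :=
  subst (fun n => Nat.casesOn n u var) t

/-- `t.HasFree z`: the variable `z` occurs free in `t`. -/
def HasFree : Tm → ℕ → Prop
  | var x, z => x = z
  | lam t, z => HasFree t (z + 1)
  | app t u, z => HasFree t z ∨ HasFree u z

end Tm

/-- Left contexts `L ::= ⟨·⟩ | v L | L t`, with `v` a value. -/
inductive LCtx : Type
  | hole : LCtx
  | valApp (v : Tm) (hv : v.IsValue) (L : LCtx) : LCtx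
  | app (L : LCtx) (t : Tm) : LCtx

namespace LCtx

/-- Plugging `L⟨t⟩`. The hole of a left context is never under a binder. -/
def plug : LCtx → Tm → Tm
  | hole, t => t
  | valApp v _ L, t => Tm.app v (L.plug t)
  | app L u, t => Tm.app (L.plug t) u

/-- `L.HasFree z`: the variable `z` occurs free in the context `L`. -/
def HasFree : LCtx → ℕ → Prop
  | hole, _ => False
  | valApp v _ L, z => v.HasFree z ∨ L.HasFree z
  | app L u, z => L.HasFree z ∨ u.HasFree z

end LCtx

/-- Root reduction `(lam x. t) v ↦ t{x ← v}`, with `v` a value. -/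
inductive RootBeta : Tm → Tm → Prop
  | beta (t v : Tm) (hv : v.IsValue) : RootBeta (Tm.app (Tm.lam t) v) (t.inst v)

/-- Left (to right) reduction: the closure of root reduction by left contexts. -/
inductive LeftRed : Tm → Tm → Prop
  | ctx (L : LCtx) {t u : Tm} (h : RootBeta t u) : LeftRed (L.plug t) (L.plug u)

/-- Left normal terms. -/
def LeftNormal (t : Tm) : Prop :=
  ∀ u, ¬ LeftRed t u

/-- Big-step left evaluation: `t` left-reduces, in some number of steps, to the left normal
term `n`. -/
def LeftEval (t n : Tm) : Prop :=
  Relation.ReflTransGen LeftRed t n ∧ LeftNormal n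

/-- Left divergence: `t` has no left normal form. -/
def LeftDiv (t : Tm) : Prop :=
  ¬ ∃ n, LeftEval t n

/-- The four clauses of eager normal form simulations. In the third one, the common bound
variable of the two abstractions is the index `0` of the two bodies. -/
inductive EnfClause (R : Tm → Tm → Prop) (t t' : Tm) : Prop
  | enf1 (h : LeftDiv t) : EnfClause R t t'
  | enf2 (x : ℕ) (h : LeftEval t (Tm.var x)) (h' : LeftEval t' (Tm.var x)) : EnfClause R t t'
  | enf3 (b b' : Tm) (h : LeftEval t (Tm.lam b)) (h' : LeftEval t' (Tm.lam b'))
      (hb : R b b') : EnfClause R t t'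
  | enf4 (L L' : LCtx) (x : ℕ) (v v' : Tm) (hv : v.IsValue) (hv' : v'.IsValue)
      (h : LeftEval t (L.plug (Tm.app (Tm.var x) v)))
      (h' : LeftEval t' (L'.plug (Tm.app (Tm.var x) v')))
      (hR : R v v')
      (z : ℕ) (hz : ¬ L.HasFree z) (hz' : ¬ L'.HasFree z)
      (hL : R (L.plug (Tm.var z)) (L'.plug (Tm.var z))) : EnfClause R t t'

/-- `R` is an eager normal form (enf) simulation. -/
def IsEnfSimulation (R : Tm → Tm → Prop) : Prop :=
  ∀ t t', R t t' → EnfClause R t t'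

/-- Enf similarity: the union of all enf simulations. -/
def EnfSimilar (t t' : Tm) : Prop :=
  ∃ R : Tm → Tm → Prop, IsEnfSimulation R ∧ R t t'

/-! ## Terms with explicit substitutions -/

/-- Terms of the value substitution calculus, `t, u ::= x | lam x. t | t u | t[x ← u]`, again with
de Bruijn indices: `es t u` is `t[x ← u]`, and binds the index `0` in `t`. -/
inductive VTm : Type
  | var : ℕ → VTm
  | lam : VTm → VTm
  | app : VTm → VTm → VTm
  | es : VTm → VTm → VTm

/-- Values of the value substitution calculus. -/
inductive VTm.IsValue : VTm → Prop
  | var (x : ℕ) : VTm.IsValue (VTm.var x)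
  | lam (t : VTm) : VTm.IsValue (VTm.lam t)

/-- Ordinary lambda-terms are the terms without explicit substitutions. -/
def Tm.toVTm : Tm → VTm
  | Tm.var x => VTm.var x
  | Tm.lam t => VTm.lam t.toVTm
  | Tm.app t u => VTm.app t.toVTm u.toVTm

/-! ## Linear and multi types

`L ::= M ⊸ N` and `M, N ::= [L₁, …, Lₙ]` with `n ≥ 0`, where `[L₁, …, Lₙ]` is a finite multiset.
Linear types are built as finite trees, with lists in place of multisets, modulo the hereditary
reordering of the lists. -/

/-- Representatives of linear types, with lists in place of multisets. -/
inductive PreLin : Type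
  | arrow : List PreLin → List PreLin → PreLin

/-- Equality of representatives up to hereditary reordering of the lists. -/
inductive PreLin.Equiv : PreLin → PreLin → Prop
  | arrow {l₁ l₂ r₁ r₂ : List PreLin}
      (hl : Multiset.Rel PreLin.Equiv (l₁ : Multiset PreLin) (l₂ : Multiset PreLin))
      (hr : Multiset.Rel PreLin.Equiv (r₁ : Multiset PreLin) (r₂ : Multiset PreLin)) :
      PreLin.Equiv (PreLin.arrow l₁ r₁) (PreLin.arrow l₂ r₂)

theorem PreLin.equiv_arrow {l₁ l₂ r₁ r₂ : List PreLin}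
    (h : PreLin.Equiv (.arrow l₁ r₁) (.arrow l₂ r₂)) :
    Multiset.Rel PreLin.Equiv (l₁ : Multiset PreLin) (l₂ : Multiset PreLin) ∧
      Multiset.Rel PreLin.Equiv (r₁ : Multiset PreLin) (r₂ : Multiset PreLin) := by
  cases h with
  | arrow hl hr => exact ⟨hl, hr⟩

theorem PreLin.induction {P : PreLin → Prop}
    (h : ∀ l r : List PreLin, (∀ a ∈ l, P a) → (∀ a ∈ r, P a) → P (.arrow l r))
    (a : PreLin) : P a := by
  refine PreLin.rec (motive_1 := P) (motive_2 := fun l => ∀ b ∈ l, P b) h ?_ ?_ a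
  · intro b hb
    cases hb
  · intro a l ha hl b hb
    rcases List.mem_cons.1 hb with rfl | hb
    · exact ha
    · exact hl b hb

theorem PreLin.equiv_refl (a : PreLin) : PreLin.Equiv a a := by
  induction a using PreLin.induction with
  | h l r hl hr => exact .arrow (Multiset.rel_refl_of_refl_on hl) (Multiset.rel_refl_of_refl_on hr)

theorem PreLin.equiv_symm (a : PreLin) : ∀ b, PreLin.Equiv a b → PreLin.Equiv b a := by
  induction a using PreLin.induction with
  | h l r hl hr =>
    rintro ⟨l', r'⟩ h
    obtain ⟨h1, h2⟩ := PreLin.equiv_arrow h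
    exact .arrow (Multiset.rel_flip.1 (h1.mono fun x hx y _ hxy => hl x hx y hxy))
      (Multiset.rel_flip.1 (h2.mono fun x hx y _ hxy => hr x hx y hxy))

theorem rel_trans_on {α : Type*} {p : α → α → Prop} {s t u : Multiset α}
    (h : Multiset.Rel (fun x y => ∀ z, p y z → p x z) s t) (h' : Multiset.Rel p t u) :
    Multiset.Rel p s u := by
  induction h generalizing u with
  | zero => exact h'
  | cons hab _ ih =>
    obtain ⟨c, u', hc, hu', rfl⟩ := Multiset.rel_cons_left.1 h'
    exact Multiset.Rel.cons (hab c hc) (ih hu')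

theorem PreLin.equiv_trans (a : PreLin) :
    ∀ b c, PreLin.Equiv a b → PreLin.Equiv b c → PreLin.Equiv a c := by
  induction a using PreLin.induction with
  | h l r hl hr =>
    rintro ⟨l', r'⟩ ⟨l'', r''⟩ h h'
    obtain ⟨h1, h2⟩ := PreLin.equiv_arrow h
    obtain ⟨h1', h2'⟩ := PreLin.equiv_arrow h'
    exact .arrow (rel_trans_on (h1.mono fun x hx y _ hxy z hyz => hl x hx y z hxy hyz) h1')
      (rel_trans_on (h2.mono fun x hx y _ hxy z hyz => hr x hx y z hxy hyz) h2')

def PreLin.setoid : Setoid PreLin where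
  r := PreLin.Equiv
  iseqv := ⟨PreLin.equiv_refl, fun {a b} => PreLin.equiv_symm a b,
    fun {a b c} => PreLin.equiv_trans a b c⟩

/-- Linear types. -/
def LinTy : Type := Quotient PreLin.setoid

/-- Multi types: finite multisets of linear types. -/
abbrev MultiTy : Type := Multiset LinTy

/-- The class of a representative. -/
def LinTy.mk (a : PreLin) : LinTy := Quotient.mk PreLin.setoid a

/-- A representative of a linear type. -/
noncomputable def LinTy.out (L : LinTy) : PreLin := Quotient.out L

theorem LinTy.mk_out (L : LinTy) : LinTy.mk L.out = L := Quotient.out_eq L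

/-- The linear type `M ⊸ N`. -/
noncomputable def LinTy.arrow (M N : MultiTy) : LinTy :=
  LinTy.mk (PreLin.arrow (M.toList.map LinTy.out) (N.toList.map LinTy.out))

/-- Multisets of representatives with the same classes are related. -/
theorem rel_of_map_mk_eq {s t : Multiset PreLin} (h : s.map LinTy.mk = t.map LinTy.mk) :
    Multiset.Rel PreLin.Equiv s t := by
  have h1 : Multiset.Rel (· = ·) (s.map LinTy.mk) (t.map LinTy.mk) := Multiset.rel_eq.2 h
  exact (Multiset.rel_map.1 h1).mono fun a _ b _ hab => Quotient.exact hab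

theorem map_mk_map_out (M : MultiTy) :
    Multiset.map LinTy.mk (↑(M.toList.map LinTy.out) : Multiset PreLin) = M := by
  have hid : LinTy.mk ∘ LinTy.out = id := funext LinTy.mk_out
  rw [Multiset.map_coe, List.map_map, hid, List.map_id, Multiset.coe_toList]

/-- The arrow of linear types is the one of representatives. -/
theorem LinTy.arrow_mk (l r : List PreLin) :
    LinTy.arrow (↑(l.map LinTy.mk)) (↑(r.map LinTy.mk)) = LinTy.mk (PreLin.arrow l r) := by
  refine Quotient.sound (s := PreLin.setoid) (PreLin.Equiv.arrow ?_ ?_) <;>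
  · apply rel_of_map_mk_eq
    rw [map_mk_map_out, Multiset.map_coe]

theorem LinTy.arrow_injective {M N M' N' : MultiTy}
    (h : LinTy.arrow M N = LinTy.arrow M' N') : M = M' ∧ N = N' := by
  have h1 := Quotient.exact h
  cases h1 with
  | arrow hl hr =>
    have hl' := Multiset.map_mk_eq_map_mk_of_rel (r := PreLin.setoid.r) hl
    have hr' := Multiset.map_mk_eq_map_mk_of_rel (r := PreLin.setoid.r) hr
    constructor
    · rw [← map_mk_map_out M, ← map_mk_map_out M']; exact hl'
    · rw [← map_mk_map_out N, ← map_mk_map_out N']; exact hr'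

/-- Linear types are generated by the arrow, inductively. -/
theorem LinTy.induction {P : LinTy → Prop}
    (h : ∀ M N : MultiTy, (∀ L ∈ M, P L) → (∀ L ∈ N, P L) → P (LinTy.arrow M N)) (L : LinTy) :
    P L := by
  have key : ∀ a : PreLin, P (LinTy.mk a) := by
    intro a
    induction a using PreLin.induction with
    | h l r hl hr =>
      rw [← LinTy.arrow_mk]
      apply h
      · intro L hL
        obtain ⟨b, hb, rfl⟩ := List.mem_map.1 (Multiset.mem_coe.1 hL)
        exact hl b hb
      · intro L hL
        obtain ⟨b, hb, rfl⟩ := List.mem_map.1 (Multiset.mem_coe.1 hL)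
        exact hr b hb
  exact Quotient.ind (s := PreLin.setoid) key L

/-! ## The multi type system -/

/-- Typing contexts assign a multi type to every variable; a variable which is absent from the
context has the empty multi type. (The contexts of the derivable judgments assign a non-empty multi
type to finitely many variables only.) The pointwise sum is the disjoint union of contexts. -/
abbrev TyCtx : Type := ℕ → MultiTy

/-- The context `x : M`. -/
def TyCtx.single (x : ℕ) (M : MultiTy) : TyCtx := Pi.single x M

/-- The context `Γ, x : M` of the body of a binder, where the bound variable `x` has index `0`. -/
def TyCtx.cons (M : MultiTy) (Γ : TyCtx) : TyCtx := fun n => Nat.casesOn n M Γ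

mutual

/-- `HasLin Γ t L`: there is a derivation of `Γ ⊢ t : L`, with `L` a linear type. -/
inductive HasLin : TyCtx → VTm → LinTy → Prop
  | ax (x : ℕ) (L : LinTy) : HasLin (TyCtx.single x {L}) (VTm.var x) L
  | lam {Γ : TyCtx} {t : VTm} {M N : MultiTy} (h : HasMulti (TyCtx.cons M Γ) t N) :
      HasLin Γ (VTm.lam t) (LinTy.arrow M N)

/-- `HasMulti Γ t M`: there is a derivation of `Γ ⊢ t : M`, with `M` a multi type. -/
inductive HasMulti : TyCtx → VTm → MultiTy → Prop
  | many {v : VTm} (hv : v.IsValue) (n : ℕ) (Γ : Fin n → TyCtx) (L : Fin n → LinTy)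
      (h : ∀ i, HasLin (Γ i) v (L i)) : HasMulti (∑ i, Γ i) v (∑ i, {L i})
  | app {Γ Δ : TyCtx} {t u : VTm} {M N : MultiTy} (ht : HasMulti Γ t {LinTy.arrow M N})
      (hu : HasMulti Δ u M) : HasMulti (Γ + Δ) (VTm.app t u) N
  | es {Γ Δ : TyCtx} {t u : VTm} {M N : MultiTy} (ht : HasMulti (TyCtx.cons M Γ) t N)
      (hu : HasMulti Δ u M) : HasMulti (Γ + Δ) (VTm.es t u) N

end

/-- The type preorder: every multi type judgment of `t` is one of `t'`. -/
def TypeLE (t t' : VTm) : Prop :=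
  ∀ (Γ : TyCtx) (M : MultiTy), HasMulti Γ t M → HasMulti Γ t' M

end CbV

namespace CbV

/-! The judgments of a term are described as the set of its pairs of a typing context and of the
size of a derivation. Seen on such sets, rule (many) is a pointwise sum over a multiset, and a
substitution of values is an additive map on contexts, so that a left reduction step shifts all the
sizes by exactly `2`: one rule (λ) and one rule (@) disappear. This identity contains both subject
reduction and subject expansion, and the decrease of sizes shows that typable terms have a left
normal form. When an enf simulation relates `t` to `t'`, the judgments of `t` are judgments of `t'`
by induction on their size in `t`, the size in `t'` being immaterial: evaluating `t` does not
increase it, and a rule is lost when the simulation passes from a normal form to its body, or to its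
left context and its argument. -/

open scoped Pointwise

/-! ### Pointwise sums of sets -/

section Pointwise

variable {α A B : Type*} [AddCommMonoid A] [AddCommMonoid B]

/-- The additive extension of `f` to multisets, which are the free commutative monoid. Applied to
the set-valued `f` that gives the linear typings of a value, it is the rule (many). -/
def multisetLift (f : α → A) : Multiset α →+ A :=
  Multiset.sumAddMonoidHom.comp (Multiset.mapAddMonoidHom f)

theorem multisetLift_cons (f : α → A) (a : α) (s : Multiset α) :
    multisetLift f (a ::ₘ s) = f a + multisetLift f s := by
  simp [multisetLift]

@[simp] theorem multisetLift_singleton (f : α → A) (a : α) : multisetLift f {a} = f a := by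
  simp [multisetLift]

theorem map_multisetLift (g : A →+ B) (f : α → A) (s : Multiset α) :
    g (multisetLift f s) = multisetLift (fun a => g (f a)) s :=
  DFunLike.congr_fun
    (Multiset.addHom_ext (f := g.comp (multisetLift f)) fun a => by simp) s

theorem multisetLift_subset {f : α → Set A} {S : AddSubmonoid A} (h : ∀ a, f a ⊆ S)
    (s : Multiset α) : multisetLift f s ⊆ S := by
  induction s using Multiset.induction with
  | empty => simp [Set.subset_def]
  | cons a s ih =>
    rw [multisetLift_cons]
    exact Set.add_subset_iff.2 fun _ hx _ hy => S.add_mem (h a hx) (ih hy)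

theorem mem_multisetLift {f : α → Set A} {s : Multiset α} {x : A} :
    x ∈ multisetLift f s ↔ ∃ (n : ℕ) (a : Fin n → α) (y : Fin n → A),
      ∑ i, {a i} = s ∧ (∀ i, y i ∈ f (a i)) ∧ ∑ i, y i = x := by
  constructor
  · intro hx
    induction s using Multiset.induction generalizing x with
    | empty => exact ⟨0, Fin.elim0, Fin.elim0, by simp, fun i => i.elim0, by simpa using hx.symm⟩
    | cons a s ih =>
      rw [multisetLift_cons] at hx
      obtain ⟨y, hy, z, hz, rfl⟩ := hx
      obtain ⟨n, b, w, rfl, hw, rfl⟩ := ih hz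
      exact ⟨n + 1, Fin.cons a b, Fin.cons y w, by simp [Fin.sum_univ_succ],
        Fin.cases hy hw, by simp [Fin.sum_univ_succ]⟩
  · rintro ⟨n, a, y, rfl, hy, rfl⟩
    rw [map_sum]
    exact Set.finsetSum_mem_finsetSum _ _ _ fun i _ => by simpa using hy i

/-- The extension of a set-valued additive map to sets. -/
def setBind (f : A →+ Set B) : Set A →+ Set B where
  toFun S := ⋃ a ∈ S, f a
  map_zero' := by simp
  map_add' S T := by
    simp_rw [← Set.image2_add (s := S), Set.biUnion_image2, map_add, Set.iUnion₂_add,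
      Set.add_iUnion₂]

theorem mem_setBind {f : A →+ Set B} {S : Set A} {b : B} :
    b ∈ setBind f S ↔ ∃ a ∈ S, b ∈ f a := by
  simp [setBind]

theorem setBind_iUnion {ι : Sort*} (f : A →+ Set B) (S : ι → Set A) :
    setBind f (⋃ i, S i) = ⋃ i, setBind f (S i) := by
  ext b
  simp only [mem_setBind, Set.mem_iUnion]
  grind

theorem setBind_singleton (f : A →+ Set B) (a : A) : setBind f {a} = f a := by
  simp [setBind]

end Pointwise

/-! ### Sized typings -/

/-- Finitely supported typing contexts, the only ones that occur in derivable judgments. -/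
abbrev FinCtx : Type := ℕ →₀ MultiTy

namespace FinCtx

/-- The context `Γ, x : M` of the body of a binder, see `TyCtx.cons`. -/
noncomputable def cons (M : MultiTy) (Γ : FinCtx) : FinCtx :=
  Finsupp.single 0 M + Γ.mapDomain Nat.succ

theorem coe_cons (M : MultiTy) (Γ : FinCtx) : ⇑(cons M Γ) = TyCtx.cons M Γ := by
  funext n
  cases n with
  | zero => simp [cons, TyCtx.cons, Finsupp.mapDomain_of_notMem_range]
  | succ n => simp [cons, TyCtx.cons, Finsupp.mapDomain_apply Nat.succ_injective]

@[simp] theorem cons_zero (M : MultiTy) (Γ : FinCtx) : cons M Γ 0 = M := by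
  rw [coe_cons]; rfl

@[simp] theorem cons_succ (M : MultiTy) (Γ : FinCtx) (x : ℕ) : cons M Γ (x + 1) = Γ x := by
  rw [coe_cons]; rfl

theorem cons_inj {M N : MultiTy} {Γ Δ : FinCtx} : cons M Γ = cons N Δ ↔ M = N ∧ Γ = Δ := by
  refine ⟨fun h => ⟨by simpa using DFunLike.congr_fun h 0, Finsupp.ext fun x => ?_⟩, ?_⟩
  · simpa using DFunLike.congr_fun h (x + 1)
  · rintro ⟨rfl, rfl⟩
    rfl

theorem exists_eq_cons (Γ : FinCtx) : ∃ M Δ, Γ = cons M Δ := by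
  refine ⟨Γ 0, Γ.comapDomain Nat.succ Nat.succ_injective.injOn, Finsupp.ext fun x => ?_⟩
  cases x <;> simp [Finsupp.comapDomain_apply]

end FinCtx

/-- Typing contexts with the size of a derivation, which is its number of rules (λ) and (@). -/
abbrev SizedCtx : Type := ℕ × FinCtx

/-- The sized contexts giving type `N` to an application, from those of its two subterms at each
type. -/
noncomputable def appTypings (D E : MultiTy → Set SizedCtx) (N : MultiTy) : Set SizedCtx :=
  ⋃ M, {(1, 0)} + D {LinTy.arrow M N} + E M

/-- The judgments of the body of a binder in which the bound variable has type `M`, as judgments on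
the other variables. -/
def unbind (M : MultiTy) (S : Set SizedCtx) : Set SizedCtx :=
  Prod.map id (FinCtx.cons M) ⁻¹' S

theorem mem_unbind {M : MultiTy} {S : Set SizedCtx} {w : SizedCtx} :
    w ∈ unbind M S ↔ (w.1, FinCtx.cons M w.2) ∈ S := Iff.rfl

/-- The sized contexts giving type `L` to an abstraction, from those of its body at each type. -/
noncomputable def lamTypings (D : MultiTy → Set SizedCtx) (L : LinTy) : Set SizedCtx :=
  ⋃ (M : MultiTy) (N : MultiTy) (_ : L = LinTy.arrow M N), {(1, 0)} + unbind M (D N)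

/-- `(n, Γ) ∈ t.typings M`: there is a derivation of `Γ ⊢ t : M` with `n` rules (λ) and (@). -/
noncomputable def Tm.typings : Tm → MultiTy → Set SizedCtx
  | .var x, M => multisetLift (fun L => {(0, Finsupp.single x {L})}) M
  | .lam b, M => multisetLift (lamTypings b.typings) M
  | .app t u, M => appTypings t.typings u.typings M

theorem Tm.typings_var (x : ℕ) (M : MultiTy) :
    (var x).typings M = {(0, Finsupp.single x M)} := by
  let single : MultiTy →+ Set SizedCtx := Set.singletonAddMonoidHom.comp
    ((AddMonoidHom.inr ℕ FinCtx).comp (Finsupp.singleAddHom x))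
  have hsingle : multisetLift (fun L => {(0, Finsupp.single x {L})}) = single :=
    Multiset.addHom_ext fun L => by simp [single]
  exact DFunLike.congr_fun hsingle M

theorem lamTypings_arrow (D : MultiTy → Set SizedCtx) (M N : MultiTy) :
    lamTypings D (LinTy.arrow M N) = {(1, 0)} + unbind M (D N) := by
  apply Set.Subset.antisymm
  · refine Set.iUnion_subset fun M' => Set.iUnion_subset fun N' => Set.iUnion_subset fun h => ?_
    obtain ⟨rfl, rfl⟩ := LinTy.arrow_injective h
    exact subset_rfl
  · exact Set.subset_iUnion_of_subset M (Set.subset_iUnion₂_of_subset N rfl subset_rfl)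

theorem Tm.IsValue.typings_eq_multisetLift {v : Tm} (hv : v.IsValue) (M : MultiTy) :
    v.typings M = multisetLift (fun L => v.typings {L}) M := by
  cases hv <;> simp [Tm.typings]

/-- The typing contexts underlying a set of sized contexts. -/
noncomputable def contexts : Set SizedCtx →+ Set TyCtx :=
  setBind (Set.singletonAddMonoidHom.comp
    (Finsupp.coeFnAddHom.comp (AddMonoidHom.snd ℕ FinCtx)))

theorem mem_contexts {S : Set SizedCtx} {Γ : TyCtx} :
    Γ ∈ contexts S ↔ ∃ n Δ, (n, Δ) ∈ S ∧ Γ = ⇑Δ := by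
  simp [contexts, mem_setBind, Finsupp.coeFnAddHom]

theorem contexts_iUnion {ι : Sort*} (S : ι → Set SizedCtx) :
    contexts (⋃ i, S i) = ⋃ i, contexts (S i) :=
  setBind_iUnion _ S

theorem contexts_singleton (n : ℕ) (Γ : FinCtx) : contexts {(n, Γ)} = {⇑Γ} :=
  setBind_singleton _ (n, Γ)

theorem contexts_appTypings (D E : MultiTy → Set SizedCtx) (N : MultiTy) :
    contexts (appTypings D E N) = ⋃ M, contexts (D {LinTy.arrow M N}) + contexts (E M) := by
  simp only [appTypings, contexts_iUnion, map_add, contexts_singleton, Finsupp.coe_zero,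
    Set.singleton_zero, zero_add]

theorem contexts_unbind (M : MultiTy) (S : Set SizedCtx) :
    contexts (unbind M S) = TyCtx.cons M ⁻¹' contexts S := by
  ext Γ
  simp only [mem_contexts, mem_unbind, Set.mem_preimage]
  constructor
  · rintro ⟨n, Δ, hΔ, rfl⟩
    exact ⟨n, FinCtx.cons M Δ, hΔ, (FinCtx.coe_cons M Δ).symm⟩
  · rintro ⟨n, Δ, hΔ, h⟩
    obtain ⟨M', Δ, rfl⟩ := Δ.exists_eq_cons
    rw [FinCtx.coe_cons] at h
    obtain rfl : M = M' := congrFun h 0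
    exact ⟨n, Δ, hΔ, funext fun x => congrFun h (x + 1)⟩

theorem contexts_lamTypings (D : MultiTy → Set SizedCtx) (L : LinTy) :
    contexts (lamTypings D L) =
      ⋃ (M : MultiTy) (N : MultiTy) (_ : L = LinTy.arrow M N),
        TyCtx.cons M ⁻¹' contexts (D N) := by
  simp only [lamTypings, contexts_iUnion, map_add, contexts_singleton, Finsupp.coe_zero,
    Set.singleton_zero, zero_add, contexts_unbind]

theorem setOf_hasMulti_of_isValue {v : VTm} (hv : v.IsValue) (M : MultiTy) :
    {Γ | HasMulti Γ v M} = multisetLift (fun L => {Γ | HasLin Γ v L}) M := by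
  ext Γ
  rw [mem_multisetLift]
  constructor
  · rintro (⟨_, n, Γ, L, h⟩ | _ | _)
    · exact ⟨n, L, Γ, rfl, h, rfl⟩
    all_goals cases hv
  · rintro ⟨n, L, Γ, rfl, h, rfl⟩
    exact .many hv n Γ L h

theorem setOf_hasMulti_app (t u : VTm) (N : MultiTy) :
    {Γ | HasMulti Γ (.app t u) N} =
      ⋃ M, {Γ | HasMulti Γ t {LinTy.arrow M N}} + {Γ | HasMulti Γ u M} := by
  ext Γ
  rw [Set.mem_iUnion]
  constructor
  · rintro (⟨⟨⟩⟩ | ⟨ht, hu⟩ | _)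
    exact ⟨_, Set.add_mem_add ht hu⟩
  · rintro ⟨M, Γ, ht, Δ, hu, rfl⟩
    exact .app ht hu

theorem setOf_hasLin_var (x : ℕ) (L : LinTy) :
    {Γ | HasLin Γ (.var x) L} = {TyCtx.single x {L}} := by
  ext Γ
  constructor
  · rintro ⟨⟩
    exact rfl
  · rintro rfl
    exact .ax x L

theorem setOf_hasLin_lam (b : VTm) (L : LinTy) :
    {Γ | HasLin Γ (.lam b) L} =
      ⋃ (M : MultiTy) (N : MultiTy) (_ : L = LinTy.arrow M N),
        TyCtx.cons M ⁻¹' {Γ | HasMulti Γ b N} := by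
  ext Γ
  simp only [Set.mem_iUnion, Set.mem_preimage]
  constructor
  · rintro (_ | h)
    exact ⟨_, _, rfl, h⟩
  · rintro ⟨M, N, rfl, h⟩
    exact .lam h

theorem Tm.contexts_typings (t : Tm) (M : MultiTy) :
    contexts (t.typings M) = {Γ | HasMulti Γ t.toVTm M} := by
  induction t generalizing M with
  | var x =>
    rw [toVTm, setOf_hasMulti_of_isValue (.var x), typings, map_multisetLift]
    simp only [contexts_singleton, setOf_hasLin_var, Finsupp.single_eq_pi_single, TyCtx.single]
  | lam b ih =>
    rw [toVTm, setOf_hasMulti_of_isValue (.lam _), typings, map_multisetLift]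
    simp only [contexts_lamTypings, setOf_hasLin_lam, ih]
  | app t u iht ihu =>
    rw [toVTm, setOf_hasMulti_app, typings, contexts_appTypings]
    simp only [iht, ihu]

/-! ### Substitution and reduction -/

/-- The effect on judgments of replacing every variable, when `τ Γ` is the set of judgments of the
replacements at the types `Γ`. -/
noncomputable def transport (τ : FinCtx →+ Set SizedCtx) : Set SizedCtx →+ Set SizedCtx :=
  setBind ((Set.singletonAddMonoidHom.comp (AddMonoidHom.inl ℕ FinCtx)).coprod τ)

theorem transport_singleton (τ : FinCtx →+ Set SizedCtx) (n : ℕ) (Γ : FinCtx) :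
    transport τ {(n, Γ)} = {(n, 0)} + τ Γ := by
  simp [transport, setBind_singleton]

theorem transport_iUnion {ι : Sort*} (τ : FinCtx →+ Set SizedCtx) (S : ι → Set SizedCtx) :
    transport τ (⋃ i, S i) = ⋃ i, transport τ (S i) :=
  setBind_iUnion _ S

theorem mem_transport {τ : FinCtx →+ Set SizedCtx} {S : Set SizedCtx} {w : SizedCtx} :
    w ∈ transport τ S ↔ ∃ n Γ k Δ, (n, Γ) ∈ S ∧ (k, Δ) ∈ τ Γ ∧ (n + k, Δ) = w := by
  simp [transport, mem_setBind, Set.singleton_add]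

/-- Adding a fresh variable `0` to the contexts. -/
noncomputable def weaken (S : Set SizedCtx) : Set SizedCtx :=
  Prod.map id (Finsupp.mapDomain Nat.succ) '' S

/-- `τ'` extends `τ` under a binder. -/
structure IsLift (τ' τ : FinCtx →+ Set SizedCtx) : Prop where
  single_zero (M : MultiTy) : τ' (Finsupp.single 0 M) = {(0, Finsupp.single 0 M)}
  mapDomain_succ (Γ : FinCtx) : τ' (Γ.mapDomain Nat.succ) = weaken (τ Γ)

theorem IsLift.map_cons {τ' τ : FinCtx →+ Set SizedCtx} (h : IsLift τ' τ) (M : MultiTy)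
    (Γ : FinCtx) : τ' (FinCtx.cons M Γ) = Prod.map id (FinCtx.cons M) '' τ Γ := by
  rw [FinCtx.cons, map_add, h.single_zero, h.mapDomain_succ, weaken, Set.singleton_add,
    Set.image_image]
  exact Set.image_congr fun w _ => Prod.ext (zero_add w.1) rfl

theorem IsLift.unbind_transport {τ' τ : FinCtx →+ Set SizedCtx} (h : IsLift τ' τ) (M : MultiTy)
    (S : Set SizedCtx) : unbind M (transport τ' S) = transport τ (unbind M S) := by
  ext ⟨l, Γ⟩
  simp only [mem_unbind, mem_transport]
  constructor
  · rintro ⟨n, Δ, k, Γ', hS, hτ, hw⟩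
    obtain ⟨N, Δ, rfl⟩ := Δ.exists_eq_cons
    rw [h.map_cons] at hτ
    obtain ⟨⟨k, Γ''⟩, hτ, ⟨⟩⟩ := hτ
    obtain ⟨rfl, hΓ⟩ := Prod.mk.inj hw
    obtain ⟨rfl, rfl⟩ := FinCtx.cons_inj.1 hΓ
    exact ⟨n, Δ, k, Γ'', hS, hτ, rfl⟩
  · rintro ⟨n, Δ, k, Γ', hS, hτ, hw⟩
    cases hw
    exact ⟨n, FinCtx.cons M Δ, k, _, hS, h.map_cons M Δ ▸ Set.mem_image_of_mem _ hτ, rfl⟩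

theorem transport_appTypings (τ : FinCtx →+ Set SizedCtx) (D E : MultiTy → Set SizedCtx)
    (N : MultiTy) :
    transport τ (appTypings D E N) =
      appTypings (fun M => transport τ (D M)) (fun M => transport τ (E M)) N := by
  simp only [appTypings, transport_iUnion, map_add, transport_singleton, map_zero, add_zero]

theorem IsLift.transport_lamTypings {τ' τ : FinCtx →+ Set SizedCtx} (h : IsLift τ' τ)
    (D : MultiTy → Set SizedCtx) (L : LinTy) :
    transport τ (lamTypings D L) = lamTypings (fun M => transport τ' (D M)) L := by
  simp only [lamTypings, transport_iUnion, map_add, transport_singleton, map_zero, add_zero,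
    h.unbind_transport]

/-- The judgments of the variables `f x`: the context `Γ` is renamed by `f`. -/
noncomputable def renameTypings (f : ℕ → ℕ) : FinCtx →+ Set SizedCtx :=
  Set.singletonAddMonoidHom.comp
    ((AddMonoidHom.inr ℕ FinCtx).comp (Finsupp.mapDomain.addMonoidHom f))

theorem renameTypings_apply (f : ℕ → ℕ) (Γ : FinCtx) :
    renameTypings f Γ = {(0, Γ.mapDomain f)} := rfl

theorem transport_renameTypings (f : ℕ → ℕ) (S : Set SizedCtx) :
    transport (renameTypings f) S = Prod.map id (Finsupp.mapDomain f) '' S := by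
  ext w
  simp [mem_transport, renameTypings_apply]

/-- The renaming `f` under a binder. -/
def liftRen (f : ℕ → ℕ) : ℕ → ℕ := fun n => Nat.casesOn n 0 (fun k => f k + 1)

theorem isLift_renameTypings (f : ℕ → ℕ) :
    IsLift (renameTypings (liftRen f)) (renameTypings f) where
  single_zero M := by simp [renameTypings_apply, liftRen]
  mapDomain_succ Γ := by
    have hcomp : liftRen f ∘ Nat.succ = Nat.succ ∘ f := rfl
    simp [renameTypings_apply, weaken, ← Finsupp.mapDomain_comp, hcomp]

theorem Tm.typings_rename (f : ℕ → ℕ) (t : Tm) (M : MultiTy) :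
    (t.rename f).typings M = transport (renameTypings f) (t.typings M) := by
  induction t generalizing f M with
  | var x => simp [rename, typings_var, transport_singleton, renameTypings_apply]
  | lam b ih =>
    simp only [rename, typings, map_multisetLift, (isLift_renameTypings f).transport_lamTypings,
      ← ih]
    rfl
  | app t u iht ihu =>
    rw [rename, typings, typings, transport_appTypings, funext (iht f), funext (ihu f)]

/-- The judgments of the terms `s x` at the types `Γ x`, merged over all variables `x`. -/
noncomputable def substTypings (s : ℕ → Tm) : FinCtx →+ Set SizedCtx :=
  Finsupp.liftAddHom fun x => multisetLift fun L => (s x).typings {L}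

theorem substTypings_single {s : ℕ → Tm} {x : ℕ} (hx : (s x).IsValue) (M : MultiTy) :
    substTypings s (Finsupp.single x M) = (s x).typings M := by
  rw [substTypings, Finsupp.liftAddHom_apply_single, ← hx.typings_eq_multisetLift]

/-- The substitution `s` under a binder. -/
def liftSubst (s : ℕ → Tm) : ℕ → Tm :=
  fun n => Nat.casesOn n (Tm.var 0) (fun k => Tm.rename Nat.succ (s k))

theorem isLift_substTypings (s : ℕ → Tm) :
    IsLift (substTypings (liftSubst s)) (substTypings s) where
  single_zero M :=
    (substTypings_single (s := liftSubst s) (x := 0) (.var 0) M).trans (Tm.typings_var 0 M)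
  mapDomain_succ Γ := by
    suffices h : (substTypings (liftSubst s)).comp (Finsupp.mapDomain.addMonoidHom Nat.succ) =
        (transport (renameTypings Nat.succ)).comp (substTypings s) by
      rw [weaken, ← transport_renameTypings]
      exact DFunLike.congr_fun h Γ
    ext x L : 3
    simp [substTypings, liftSubst, Tm.typings_rename]

theorem Tm.IsValue.rename {v : Tm} (hv : v.IsValue) (f : ℕ → ℕ) : (v.rename f).IsValue := by
  cases hv <;> constructor

theorem liftSubst_isValue {s : ℕ → Tm} (hs : ∀ x, (s x).IsValue) :
    ∀ x, (liftSubst s x).IsValue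
  | 0 => .var 0
  | x + 1 => (hs x).rename Nat.succ

theorem Tm.typings_subst {s : ℕ → Tm} (hs : ∀ x, (s x).IsValue) (t : Tm) (M : MultiTy) :
    (t.subst s).typings M = transport (substTypings s) (t.typings M) := by
  induction t generalizing s M with
  | var x =>
    simp only [subst, typings_var, transport_singleton, substTypings_single (hs x),
      Prod.mk_zero_zero, Set.singleton_zero, zero_add]
  | lam b ih =>
    simp only [subst, typings, map_multisetLift, (isLift_substTypings s).transport_lamTypings,
      ← ih (liftSubst_isValue hs)]
    rfl
  | app t u iht ihu =>
    rw [subst, typings, typings, transport_appTypings, funext (iht hs), funext (ihu hs)]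

/-- The substitution performed by `Tm.inst`. -/
def instSubst (v : Tm) : ℕ → Tm := fun n => Nat.casesOn n v Tm.var

theorem substTypings_instSubst_cons {v : Tm} (hv : v.IsValue) (M : MultiTy) (Γ : FinCtx) :
    substTypings (instSubst v) (FinCtx.cons M Γ) = v.typings M + {(0, Γ)} := by
  have hsucc : (substTypings (instSubst v)).comp (Finsupp.mapDomain.addMonoidHom Nat.succ) =
      Set.singletonAddMonoidHom.comp (AddMonoidHom.inr ℕ FinCtx) := by
    ext x L : 3
    simp [substTypings, instSubst, Tm.typings_var]
  rw [FinCtx.cons, map_add, substTypings_single (s := instSubst v) (x := 0) hv]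
  exact congrArg _ (DFunLike.congr_fun hsucc Γ)

theorem Tm.typings_inst {v : Tm} (hv : v.IsValue) (t : Tm) (N : MultiTy) :
    (t.inst v).typings N = ⋃ M, unbind M (t.typings N) + v.typings M := by
  have hs : ∀ x, (instSubst v x).IsValue
    | 0 => hv
    | x + 1 => .var x
  refine (typings_subst hs t N).trans (Set.ext fun w => ?_)
  simp only [mem_transport, Set.mem_iUnion, Set.mem_add, mem_unbind]
  constructor
  · rintro ⟨n, Γ, k, Δ, ht, hΓ, rfl⟩
    obtain ⟨M, Γ, rfl⟩ := Γ.exists_eq_cons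
    rw [substTypings_instSubst_cons hv, Set.add_singleton] at hΓ
    obtain ⟨⟨l, Ξ⟩, hw, ⟨⟩⟩ := hΓ
    exact ⟨M, (n, Γ), ht, (l, Ξ), hw, by simp [add_comm]⟩
  · rintro ⟨M, ⟨n, Γ⟩, ht, ⟨k, Δ⟩, hv', rfl⟩
    refine ⟨n, _, k, Γ + Δ, ht, ?_, rfl⟩
    rw [substTypings_instSubst_cons hv, Set.add_singleton]
    exact ⟨(k, Δ), hv', by simp [add_comm]⟩

theorem RootBeta.typings_eq {t u : Tm} (h : RootBeta t u) (M : MultiTy) :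
    t.typings M = {(2, 0)} + u.typings M := by
  obtain ⟨b, v, hv⟩ := h
  have htwo : ({(1, 0)} + {(1, 0)} : Set SizedCtx) = {(2, 0)} := by
    rw [Set.singleton_add_singleton, Prod.mk_add_mk, add_zero]
  simp only [Tm.typings_inst hv, Tm.typings, appTypings, multisetLift_singleton, lamTypings_arrow,
    Set.add_iUnion, ← add_assoc, htwo]

theorem LeftRed.typings_eq {t u : Tm} (h : LeftRed t u) (M : MultiTy) :
    t.typings M = {(2, 0)} + u.typings M := by
  obtain ⟨L, h⟩ := h
  induction L generalizing M with
  | hole => exact h.typings_eq M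
  | valApp v hv L ih =>
    simp only [LCtx.plug, Tm.typings, appTypings, ih, Set.add_iUnion,
      add_left_comm _ ({(2, 0)} : Set SizedCtx)]
  | app L t ih =>
    simp only [LCtx.plug, Tm.typings, appTypings, ih, Set.add_iUnion, add_assoc,
      add_left_comm _ ({(2, 0)} : Set SizedCtx)]

theorem LeftEval.exists_typings_eq {t u : Tm} (h : LeftEval t u) :
    ∃ k : ℕ, ∀ M, t.typings M = {(k, 0)} + u.typings M := by
  obtain ⟨hred, -⟩ := h
  induction hred using Relation.ReflTransGen.head_induction_on with
  | refl => exact ⟨0, fun M => by rw [Prod.mk_zero_zero, Set.singleton_zero, zero_add]⟩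
  | head h _ ih =>
    obtain ⟨k, hk⟩ := ih
    exact ⟨2 + k, fun M => by
      rw [h.typings_eq, hk, ← add_assoc, Set.singleton_add_singleton, Prod.mk_add_mk, add_zero]⟩

theorem Tm.exists_leftEval_of_mem_typings {t : Tm} {M : MultiTy} {w : SizedCtx}
    (hw : w ∈ t.typings M) : ∃ u, LeftEval t u := by
  induction hn : w.1 using Nat.strong_induction_on generalizing t w with
  | h n ih =>
    by_cases ht : LeftNormal t
    · exact ⟨t, .refl, ht⟩
    · obtain ⟨u, htu⟩ := not_forall_not.1 ht
      rw [htu.typings_eq, Set.singleton_add] at hw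
      obtain ⟨w', hw', rfl⟩ := hw
      obtain ⟨u', huu', hu'⟩ := ih w'.1 (by simp [← hn]) hw' rfl
      exact ⟨u', .head htu huu', hu'⟩

/-! ### Left contexts -/

/-- The sized contexts giving type `M` to `L⟨t⟩` when the hole is used at type `A`, without the
contribution of `t`. -/
noncomputable def LCtx.typings : LCtx → MultiTy → MultiTy → Set SizedCtx
  | hole, A, M => {w | w = 0 ∧ M = A}
  | valApp v _ L, A, M => appTypings v.typings (L.typings A) M
  | app L u, A, M => appTypings (L.typings A) u.typings M

theorem LCtx.typings_plug (L : LCtx) (t : Tm) (M : MultiTy) :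
    (L.plug t).typings M = ⋃ A, L.typings A M + t.typings A := by
  induction L generalizing M with
  | hole =>
    ext w
    simp [plug, typings, Set.mem_add, -Prod.exists]
  | valApp v hv L ih =>
    simp only [plug, Tm.typings, typings, appTypings, ih, Set.add_iUnion, Set.iUnion_add,
      add_assoc]
    exact Set.iUnion_comm _
  | app L u ih =>
    simp only [plug, Tm.typings, typings, appTypings, ih, Set.add_iUnion, Set.iUnion_add,
      add_assoc, add_comm (u.typings _)]
    exact Set.iUnion_comm _

/-- The sized contexts giving no type to `z`. -/
noncomputable def freshFor (z : ℕ) : AddSubmonoid SizedCtx :=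
  AddMonoidHom.mker ((Finsupp.applyAddHom z).comp (AddMonoidHom.snd ℕ FinCtx))

theorem mem_freshFor {z : ℕ} {w : SizedCtx} : w ∈ freshFor z ↔ w.2 z = 0 := Iff.rfl

theorem singleton_subset_freshFor (n z : ℕ) : {(n, 0)} ⊆ (freshFor z : Set SizedCtx) :=
  Set.singleton_subset_iff.2 (mem_freshFor.2 rfl)

theorem appTypings_subset_freshFor {D E : MultiTy → Set SizedCtx} {z : ℕ}
    (hD : ∀ M, D M ⊆ freshFor z) (hE : ∀ M, E M ⊆ freshFor z) (N : MultiTy) :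
    appTypings D E N ⊆ freshFor z :=
  Set.iUnion_subset fun M =>
    AddSubmonoid.add_subset (AddSubmonoid.add_subset (singleton_subset_freshFor 1 z) (hD _)) (hE M)

theorem lamTypings_subset_freshFor {D : MultiTy → Set SizedCtx} {z : ℕ}
    (hD : ∀ M, D M ⊆ freshFor (z + 1)) (L : LinTy) : lamTypings D L ⊆ freshFor z :=
  Set.iUnion_subset fun M => Set.iUnion₂_subset fun N _ =>
    AddSubmonoid.add_subset (singleton_subset_freshFor 1 z) fun w hw =>
      mem_freshFor.2 ((FinCtx.cons_succ M w.2 z).symm.trans (hD N hw))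

theorem Tm.typings_subset_freshFor {t : Tm} {z : ℕ} (hz : ¬ t.HasFree z) (M : MultiTy) :
    t.typings M ⊆ freshFor z := by
  induction t generalizing z M with
  | var x =>
    rw [typings_var, Set.singleton_subset_iff]
    exact Finsupp.single_eq_of_ne fun h => hz h.symm
  | lam b ih => exact multisetLift_subset (lamTypings_subset_freshFor (ih hz)) M
  | app t u iht ihu =>
    obtain ⟨ht, hu⟩ := not_or.1 hz
    exact appTypings_subset_freshFor (iht ht) (ihu hu) M

theorem LCtx.typings_subset_freshFor {L : LCtx} {z : ℕ} (hz : ¬ L.HasFree z) (A M : MultiTy) :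
    L.typings A M ⊆ freshFor z := by
  induction L generalizing M with
  | hole =>
    rintro w ⟨rfl, -⟩
    exact zero_mem _
  | valApp v hv L ih =>
    obtain ⟨hv, hL⟩ := not_or.1 hz
    exact appTypings_subset_freshFor (Tm.typings_subset_freshFor hv) (ih hL) M
  | app L u ih =>
    obtain ⟨hL, hu⟩ := not_or.1 hz
    exact appTypings_subset_freshFor (ih hL) (Tm.typings_subset_freshFor hu) M

theorem LCtx.mem_typings_plug_var {L : LCtx} {z : ℕ} (hz : ¬ L.HasFree z) {A M : MultiTy}
    {n : ℕ} {Γ : FinCtx} (hΓ : Γ z = 0) :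
    (n, Γ + Finsupp.single z A) ∈ (L.plug (.var z)).typings M ↔ (n, Γ) ∈ L.typings A M := by
  simp only [typings_plug, Tm.typings_var, Set.mem_iUnion, Set.add_singleton, Set.mem_image]
  constructor
  · rintro ⟨B, ⟨k, Δ⟩, hΔ, h⟩
    obtain ⟨hk, h⟩ := Prod.mk.inj h
    have hΔz : Δ z = 0 := typings_subset_freshFor hz B M hΔ
    obtain rfl : B = A := by simpa [hΔz, hΓ] using DFunLike.congr_fun h z
    obtain rfl := add_right_cancel h
    rwa [← hk]
  · exact fun h => ⟨A, (n, Γ), h, by simp⟩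

/-! ### Simulations -/

/-- Every context of `S` whose size is less than `n` is, with some size, a context of `T`. -/
def SubsetBelow (n : ℕ) (S T : Set SizedCtx) : Prop :=
  ∀ w ∈ S, w.1 < n → ∃ k, (k, w.2) ∈ T

namespace SubsetBelow

variable {n : ℕ} {S T S' T' : Set SizedCtx}

protected theorem rfl : SubsetBelow n S S := fun w hw _ => ⟨w.1, hw⟩

theorem mono {m : ℕ} (hmn : m ≤ n) (h : SubsetBelow n S T) : SubsetBelow m S T :=
  fun w hw hm => h w hw (hm.trans_le hmn)

theorem add (h : SubsetBelow n S T) (h' : SubsetBelow n S' T') :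
    SubsetBelow n (S + S') (T + T') := by
  rintro _ ⟨w, hw, w', hw', _, _⟩ hn
  obtain ⟨k, hk⟩ := h w hw ((Nat.le_add_right _ _).trans_lt hn)
  obtain ⟨k', hk'⟩ := h' w' hw' ((Nat.le_add_left _ _).trans_lt hn)
  exact ⟨k + k', Set.add_mem_add hk hk'⟩

theorem iUnion {ι : Sort*} {S T : ι → Set SizedCtx} (h : ∀ i, SubsetBelow n (S i) (T i)) :
    SubsetBelow n (⋃ i, S i) (⋃ i, T i) := by
  rintro w hw hn
  obtain ⟨i, hi⟩ := Set.mem_iUnion.1 hw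
  obtain ⟨k, hk⟩ := h i w hi hn
  exact ⟨k, Set.mem_iUnion_of_mem i hk⟩

protected theorem multisetLift {α : Type*} {f g : α → Set SizedCtx}
    (h : ∀ a, SubsetBelow n (f a) (g a)) (s : Multiset α) :
    SubsetBelow n (multisetLift f s) (multisetLift g s) := by
  induction s using Multiset.induction with
  | empty => simpa only [map_zero] using SubsetBelow.rfl
  | cons a s ih => simpa only [multisetLift_cons] using (h a).add ih

theorem shift (k l : ℕ) (h : SubsetBelow n S T) :
    SubsetBelow (k + n) ({(k, 0)} + S) ({(l, 0)} + T) := by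
  simp only [SubsetBelow, Set.singleton_add, Set.forall_mem_image]
  intro w hw hn
  obtain ⟨m, hm⟩ := h w hw (Nat.lt_of_add_lt_add_left hn)
  exact ⟨l + m, (m, w.2), hm, by simp⟩

protected theorem unbind (h : SubsetBelow n S T) (M : MultiTy) :
    SubsetBelow n (unbind M S) (unbind M T) :=
  fun _ hw hn => h _ hw hn

end SubsetBelow

/-- The type preorder `t ≼ t'` for the derivations of the judgments of `t` of size less than `n`. -/
def TypeLEBelow (n : ℕ) (t t' : Tm) : Prop :=
  ∀ M, SubsetBelow n (t.typings M) (t'.typings M)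

namespace TypeLEBelow

variable {n : ℕ}

theorem lam {b b' : Tm} (h : TypeLEBelow n b b') : TypeLEBelow (1 + n) (.lam b) (.lam b') :=
  SubsetBelow.multisetLift fun _ => .iUnion fun M => .iUnion fun N => .iUnion fun _ =>
    ((h N).unbind M).shift 1 1

theorem typings_lctx {L L' : LCtx} {z : ℕ} (hz : ¬ L.HasFree z) (hz' : ¬ L'.HasFree z)
    (h : TypeLEBelow n (L.plug (.var z)) (L'.plug (.var z))) (A M : MultiTy) :
    SubsetBelow n (L.typings A M) (L'.typings A M) := by
  rintro ⟨k, Γ⟩ hΓ hk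
  have hΓz : Γ z = 0 := LCtx.typings_subset_freshFor hz A M hΓ
  obtain ⟨l, hl⟩ := h M _ ((LCtx.mem_typings_plug_var hz hΓz).2 hΓ) hk
  exact ⟨l, (LCtx.mem_typings_plug_var hz' hΓz).1 hl⟩

theorem plug_var_app {L L' : LCtx} {v v' : Tm} {z : ℕ} (x : ℕ) (hv : TypeLEBelow n v v')
    (hz : ¬ L.HasFree z) (hz' : ¬ L'.HasFree z)
    (hL : TypeLEBelow n (L.plug (.var z)) (L'.plug (.var z))) :
    TypeLEBelow (1 + n) (L.plug (.app (.var x) v)) (L'.plug (.app (.var x) v')) := by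
  intro M
  simp only [LCtx.typings_plug, Tm.typings, appTypings, Set.add_iUnion, add_assoc,
    add_left_comm _ ({(1, 0)} : Set SizedCtx)]
  exact .iUnion fun A => .iUnion fun B =>
    ((hL.typings_lctx hz hz' A M).add (.add .rfl (hv B))).shift 1 1

theorem of_leftEval {t t' u u' : Tm} (ht : LeftEval t u) (ht' : LeftEval t' u')
    (h : TypeLEBelow n u u') : TypeLEBelow n t t' := by
  obtain ⟨k, hk⟩ := ht.exists_typings_eq
  obtain ⟨l, hl⟩ := ht'.exists_typings_eq
  intro M
  rw [hk, hl]
  exact ((h M).shift k l).mono (Nat.le_add_left n k)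

end TypeLEBelow

theorem IsEnfSimulation.typeLEBelow {R : Tm → Tm → Prop} (hR : IsEnfSimulation R) (n : ℕ)
    {t t' : Tm} (htt' : R t t') : TypeLEBelow n t t' := by
  induction n generalizing t t' with
  | zero => exact fun _ _ _ hn => absurd hn (Nat.not_lt_zero _)
  | succ n ih =>
    rw [add_comm n 1]
    cases hR t t' htt' with
    | enf1 h => exact fun _ _ hw _ => absurd (Tm.exists_leftEval_of_mem_typings hw) h
    | enf2 x h h' => exact .of_leftEval h h' fun _ => .rfl
    | enf3 b b' h h' hb => exact .of_leftEval h h' (ih hb).lam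
    | enf4 L L' x v v' _ _ h h' hv z hz hz' hL =>
      exact .of_leftEval h h' (.plug_var_app x (ih hv) hz hz' (ih hL))

theorem IsEnfSimulation.hasMulti {R : Tm → Tm → Prop} (hR : IsEnfSimulation R) {t t' : Tm}
    (htt' : R t t') {Γ : TyCtx} {M : MultiTy} (h : HasMulti Γ t.toVTm M) :
    HasMulti Γ t'.toVTm M := by
  obtain ⟨n, Δ, hΔ, rfl⟩ := mem_contexts.1 ((t.contexts_typings M).superset h)
  obtain ⟨k, hk⟩ := hR.typeLEBelow (n + 1) htt' M _ hΔ n.lt_succ_self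
  exact (t'.contexts_typings M).subset (mem_contexts.2 ⟨k, Δ, hk, rfl⟩)

end CbV

theorem propositionl :
    (∀ R : CbV.Tm → CbV.Tm → Prop, CbV.IsEnfSimulation R →
      ∀ t t' : CbV.Tm, R t t' →
        ∀ (Γ : CbV.TyCtx) (M : CbV.MultiTy),
          CbV.HasMulti Γ t.toVTm M → CbV.HasMulti Γ t'.toVTm M) ∧
    (∀ t t' : CbV.Tm, CbV.EnfSimilar t t' → CbV.TypeLE t.toVTm t'.toVTm) :=
  ⟨fun _ hR _ _ htt' _ _ h => hR.hasMulti htt' h,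
    fun _ _ ⟨_, hR, htt'⟩ _ _ h => hR.hasMulti htt' h⟩
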